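/- Let $p$ be a prime, let $n\ge 1$, and regard $\mathrm{GF}(p)$ as the prime field of $\mathrm{GF}(p^n)$. A function $g:\mathrm{GF}(p^n)^*\to \mathrm{GF}(p)$ is called balanced if it takes the value $0$ exactly $p^{n-1}-1$ times and each nonzero value of $\mathrm{GF}(p)$ exactly $p^{n-1}$ times. A function $f:\mathrm{GF}(p^n)^*\to \mathrm{GF}(p)$ is called difference balanced if, for each $a\in \mathrm{GF}(p^n)^*\setminus\{1\}$, the function $x\mapsto f(ax)-f(x)$ is balanced. For an integer $d$, a function $g:\mathrm{GF}(p^n)^*\to \mathrm{GF}(p)$ is called $d$-homogeneous if $\gcd(d,p-1)=1$ and $g(ax)=a^d g(x)$ for all $a\in \mathrm{GF}(p)^*$ and all $x\in \mathrm{GF}(p^n)^*$. Let $f:\mathrm{GF}(p^n)^*\to \mathrm{GF}(p)$ be difference balanced. If $f$ is balanced, then $f$ is $d$-homogeneous for some integer $d$. In general, there is $b\in \mathrm{GF}(p)$ such that $f-b$ is balanced and $f-b$ is $d$-homogeneous for some integer $d$. -/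

import Mathlib

/-- A function `f` from the multiplicative group of `K = GF(q^n)` to `F = GF(q)` is balanced
if it takes the value `0` exactly `q^(n-1) - 1` times and every nonzero value exactly
`q^(n-1)` times. -/
def IsBalanced {F K : Type*} [Field F] [Field K] (n : ℕ) (f : Kˣ → F) : Prop :=
  Nat.card {x : Kˣ // f x = 0} = Nat.card F ^ (n - 1) - 1 ∧
    ∀ b : F, b ≠ 0 → Nat.card {x : Kˣ // f x = b} = Nat.card F ^ (n - 1)

/-- `f` is difference balanced if `x ↦ f (a x) - f x` is balanced for every `a ≠ 1`. -/
def IsDifferenceBalanced {F K : Type*} [Field F] [Field K] (n : ℕ) (f : Kˣ → F) : Prop :=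
  ∀ a : Kˣ, a ≠ 1 → IsBalanced n (fun x : Kˣ => f (a * x) - f x)

/-- `f` is `d`-homogeneous: `gcd(d, q - 1) = 1` and `f (a x) = a^d f x` for all nonzero
`a` in `F = GF(q)` and all nonzero `x` in `K`. -/
def IsHomogeneousOfDegree {F K : Type*} [Field F] [Field K] [Algebra F K]
    (d : ℤ) (f : Kˣ → F) : Prop :=
  Int.gcd d ((Nat.card F : ℤ) - 1) = 1 ∧
    ∀ (a : Fˣ) (x : Kˣ),
      f (Units.map (algebraMap F K : F →* K) a * x) = (a : F) ^ d * f x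

/-! Let `f` be balanced, `e` a nontrivial additive character and `θ` a faithful character of `Kˣ`.
Difference balance makes the Gauss-type sums `X j = ∑ θ^j(x) e(f x)`, `j ≠ 0`, satisfy `X j * X' j =
p ^ n`, where `X'` uses the inverse characters. If `σ` raises `ζ` to the power `t` and fixes the
values of `θ`, it preserves every prime above `p`, so `X j ∣ σ (X j)` and `p ^ n ∣ σ (X j) * X' j`.
Fourier inversion shows that each correlation `∑ e(t f(ax) - f x)` is `-1` modulo `p ^ n`
(`prime_pow_dvd_correlation_add_one`).

By `prime_pow_dvd_coeff_sub` the fibre counts of `t f(ax) - f x` are then congruent modulo `p ^ n`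
(with one added at `0`), while their total is `p ^ n`: this function is either zero or balanced. It
cannot be balanced for all `a`, as the correlations sum to `1`. Hence scaling `f` by `t` is a shift
of `f`, and these shifts form the subgroup of order `p - 1` of `Kˣ`, namely the image of `(ZMod
p)ˣ`; homogeneity follows.

For general `f`, a second-moment count of fibres yields the constant `b`. -/

/-- The ring of integers of the `p * N`-th cyclotomic field, with the automorphisms that fix the
`N`-th roots of unity; these act trivially modulo `ζ - 1`. -/
theorem exists_cyclotomic_ring (p N : ℕ) [Fact p.Prime] [NeZero N] (hpN : Nat.Coprime p N) :
    ∃ (R : Type) (_ : CommRing R) (_ : IsDedekindDomain R),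
      (∀ m k : ℤ, (m : R) ∣ (k : R) → m ∣ k) ∧
      ∃ ζ ξ : R, IsPrimitiveRoot ζ p ∧ IsPrimitiveRoot ξ N ∧
        ∀ t : ℕ, Nat.Coprime t p → ∃ σ : R →+* R,
          σ ζ = ζ ^ t ∧ σ ξ = ξ ∧ ∀ y, ζ - 1 ∣ σ y - y := by
  have hp : p.Prime := Fact.out
  have : NeZero (p * N) := ⟨mul_ne_zero hp.ne_zero (NeZero.ne N)⟩
  let L := CyclotomicField (p * N) ℚ
  have hcyc : IsCyclotomicExtension {p * N} ℚ L :=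
    CyclotomicField.isCyclotomicExtension (p * N) ℚ
  have : NumberField L := IsCyclotomicExtension.numberField {p * N} ℚ L
  have hz := IsCyclotomicExtension.zeta_spec (p * N) ℚ L
  have hω := hz.toInteger_isPrimitiveRoot
  set ω : NumberField.RingOfIntegers L := hz.toInteger with hωdef
  have hpos : 0 < p * N := NeZero.pos _
  refine ⟨NumberField.RingOfIntegers L, inferInstance, inferInstance, ?_, ω ^ N, ω ^ p,
    hω.pow hpos (mul_comm _ _), hω.pow hpos rfl, ?_⟩
  · rintro m k ⟨c, hc⟩
    by_cases hm : m = 0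
    · subst hm
      have : k = 0 := by simpa using hc
      simp [this]
    have hint : IsIntegral ℤ ((k / m : ℚ)) := by
      have hcL : (algebraMap ℚ L) (k / m : ℚ) = (c : L) := by
        have hmL : (m : L) ≠ 0 := by exact_mod_cast hm
        have := congrArg (algebraMap (NumberField.RingOfIntegers L) L) hc
        simp only [map_mul, map_intCast] at this
        simp only [map_div₀, map_intCast]
        rw [div_eq_iff hmL, this, mul_comm]
      have h2 : IsIntegral ℤ (algebraMap ℚ L (k / m : ℚ)) := by
        rw [hcL]; exact NumberField.RingOfIntegers.isIntegral_coe c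
      exact (isIntegral_algebraMap_iff (algebraMap ℚ L).injective).1 h2
    obtain ⟨z, hz⟩ := IsIntegrallyClosed.isIntegral_iff.1 hint
    refine ⟨z, ?_⟩
    have hmQ : (m : ℚ) ≠ 0 := by exact_mod_cast hm
    have h3 : (z : ℚ) = k / m := by simpa using hz
    rw [eq_div_iff hmQ] at h3
    have h4 : (k : ℚ) = m * z := by rw [← h3, mul_comm]
    exact_mod_cast h4
  · intro t ht
    -- The exponent `s` acts as `t` on `p`-th roots of unity and trivially on `N`-th ones.
    obtain ⟨s, hs1, hs2⟩ := Nat.chineseRemainder hpN t 1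
    have hsp : Nat.Coprime s p := by
      rw [Nat.Coprime, hs1.gcd_eq]; exact ht
    have hsN : Nat.Coprime s N := by
      rw [Nat.Coprime, hs2.gcd_eq]; simp
    have hs : Nat.Coprime s (p * N) := Nat.Coprime.mul_right hsp hsN
    have hμ := hz.pow_of_coprime s hs
    let τ := IsCyclotomicExtension.fromZetaAut hμ
      (Polynomial.cyclotomic.irreducible_rat hpos)
    have hτ : τ (IsCyclotomicExtension.zeta (p * N) ℚ L) =
      IsCyclotomicExtension.zeta (p * N) ℚ L ^ s :=
      IsCyclotomicExtension.fromZetaAut_spec hμ (Polynomial.cyclotomic.irreducible_rat hpos)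
    let σ : NumberField.RingOfIntegers L →+* NumberField.RingOfIntegers L :=
      NumberField.RingOfIntegers.mapRingHom (τ : L →+* L)
    have hσ : σ ω = ω ^ s := by
      apply NumberField.RingOfIntegers.ext
      rw [NumberField.RingOfIntegers.mapRingHom_apply]
      exact hτ.trans (map_pow (algebraMap _ L) ω s).symm
    have key : ∀ i j k, i * k ≡ j * k [MOD (p * N)] → (ω ^ k) ^ i = (ω ^ k) ^ j := by
      intro i j k h
      rw [← pow_mul, ← pow_mul, mul_comm k, mul_comm k]
      exact pow_eq_pow_of_modEq h hω.pow_eq_one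
    refine ⟨σ, ?_, ?_, ?_⟩
    · rw [map_pow, hσ, pow_right_comm]
      exact key _ _ _ (hs1.mul_right' N)
    · rw [map_pow, hσ, pow_right_comm]
      have := key s 1 p (by rw [mul_comm p N]; exact hs2.mul_right' p)
      simpa using this
    · intro y
      -- The ring is generated by `ω`, and the claim passes to sums and products.
      have hy : y ∈ Algebra.adjoin ℤ {ω} := by
        rw [IsCyclotomicExtension.Rat.adjoin_singleton_eq_top hz]; trivial
      induction hy using Algebra.adjoin_induction with
      | mem x hx =>
        rw [Set.mem_singleton_iff.1 hx, hσ]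
        by_cases hs0 : s = 0
        · subst hs0
          have : N = 1 := by simpa using hsN
          subst this
          have : p = 1 := by simpa using hsp
          exact absurd this hp.one_lt.ne'
        have h1 : N ∣ s - 1 := (Nat.modEq_iff_dvd' (Nat.one_le_iff_ne_zero.2 hs0)).1 hs2.symm
        obtain ⟨r, hr⟩ := h1
        have : s = N * r + 1 := by omega
        rw [this, pow_succ, pow_mul]
        have h2 : ω ^ N - 1 ∣ (ω ^ N) ^ r - 1 := sub_one_dvd_pow_sub_one _ _
        have h3 : (ω ^ N) ^ r * ω - ω = ((ω ^ N) ^ r - 1) * ω := by ring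
        rw [h3]
        exact h2.mul_right _
      | algebraMap r => simp
      | add x y _ _ hx hy =>
        have : σ (x + y) - (x + y) = (σ x - x) + (σ y - y) := by rw [map_add]; ring
        rw [this]; exact dvd_add hx hy
      | mul x y _ _ hx hy =>
        have : σ (x * y) - x * y = (σ x - x) * σ y + x * (σ y - y) := by rw [map_mul]; ring
        rw [this]; exact dvd_add (hx.mul_right _) (hy.mul_left _)

/-! ### Divisibility above `p` -/

section Cyclotomic

variable {R : Type*} [CommRing R] {p : ℕ}

/-- Expand `((ζ - 1) + 1) ^ p`: the middle terms are multiples of `p`. Thus a prime ideal containing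
`p` contains `ζ - 1`. -/
theorem prime_dvd_sub_one_pow (hp : p.Prime) {ζ : R} (hζ : ζ ^ p = 1) :
    (p : R) ∣ (ζ - 1) ^ p := by
  obtain ⟨r, hr⟩ := exists_add_pow_prime_eq hp (ζ - 1) 1
  refine ⟨-((ζ - 1) * r), ?_⟩
  rw [sub_add_cancel, hζ] at hr
  linear_combination -hr

/-- An endomorphism that preserves every prime ideal above `p` maps a divisor of a power of `p`
to a multiple of itself. -/
theorem dvd_map_of_dvd_prime_pow [IsDedekindDomain R] (hp : p.Prime) {ζ : R} (hζ : ζ ^ p = 1)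
    (σ : R →+* R) (hσ : ∀ y, ζ - 1 ∣ σ y - y) {n : ℕ} {x : R} (hx : x ∣ (p : R) ^ n) :
    x ∣ σ x := by
  have key : ∀ I : Ideal R, (p : R) ^ n ∈ I → I.map σ ≤ I := by
    intro I
    induction I using UniqueFactorizationMonoid.induction_on_prime with
    | h₁ => intro _; rw [Ideal.zero_eq_bot, Ideal.map_bot]
    | h₂ I hI => intro _; rw [Ideal.isUnit_iff.1 hI]; exact le_top
    | h₃ I P _ hP ih =>
      intro h
      have hPp : P.IsPrime := Ideal.isPrime_of_prime hP
      have hpnP : (p : R) ^ n ∈ P := (Ideal.mul_le_left : P * I ≤ P) h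
      have hpnI : (p : R) ^ n ∈ I := (Ideal.mul_le_right : P * I ≤ I) h
      have hpP : (p : R) ∈ P := hPp.mem_of_pow_mem n hpnP
      have hζP : ζ - 1 ∈ P :=
        hPp.mem_of_pow_mem p (P.mem_of_dvd (prime_dvd_sub_one_pow hp hζ) hpP)
      rw [Ideal.map_mul]
      refine Ideal.mul_mono ?_ (ih hpnI)
      rw [Ideal.map_le_iff_le_comap]
      intro y hy
      have := P.add_mem (P.mem_of_dvd (hσ y) hζP) hy
      simpa using this
  have h := key (Ideal.span {x}) (Ideal.mem_span_singleton.2 hx)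
  rw [Ideal.map_span, Set.image_singleton, Ideal.span_singleton_le_span_singleton] at h
  exact h

/-- If `p ^ n` divides an integral combination of the `p`-th roots of unity, then the coefficients
are congruent modulo `p ^ n`. -/
theorem prime_pow_dvd_coeff_sub [IsDomain R] [Fact p.Prime]
    (hR : ∀ m k : ℤ, (m : R) ∣ (k : R) → m ∣ k) {ζ : R} (hζ : IsPrimitiveRoot ζ p)
    (hσ : ∀ t : ℕ, Nat.Coprime t p → ∃ σ : R →+* R, σ ζ = ζ ^ t)
    {n : ℕ} (hn : 1 ≤ n) (m : ZMod p → ℤ)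
    (hdvd : (p : R) ^ n ∣ ∑ c, (m c : R) * AddChar.zmodChar p hζ.pow_eq_one c) (c₀ c₁ : ZMod p) :
    (p : ℤ) ^ n ∣ m c₀ - m c₁ := by
  have hp : p.Prime := Fact.out
  have hp0 : (p : R) ≠ 0 := by
    intro h
    have := hR 0 p (by simp [h])
    simp [hp.ne_zero] at this
  have hprim := AddChar.zmodChar_primitive_of_primitive_root p hζ
  set e := AddChar.zmodChar p hζ.pow_eq_one with he
  -- Conjugating the hypothesis gives `p ^ n`; the difference of two roots of unity supplies the
  -- extra factor `ζ - 1`.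
  have hterm : ∀ s : ZMod p, (p : R) ^ n * (ζ - 1) ∣
      (e (s * -c₀) - e (s * -c₁)) * ∑ c, (m c : R) * e (s * c) := by
    intro s
    by_cases hs : s = 0
    · simp [hs]
    obtain ⟨σ, h⟩ := hσ s.val (ZMod.val_coe_unit_coprime (Units.mk0 s hs))
    have hσe : ∀ c, σ (e c) = e (s * c) := by
      intro c
      rw [he, AddChar.zmodChar_apply, map_pow, h, ← pow_mul]
      have : s * c = ((s.val * c.val : ℕ) : ZMod p) := by simp
      rw [this, AddChar.zmodChar_apply']
    have h1 : (p : R) ^ n ∣ ∑ c, (m c : R) * e (s * c) := by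
      have := map_dvd σ hdvd
      simpa [hσe] using this
    have h2 : ∀ c, ζ - 1 ∣ e c - 1 := by
      intro c
      rw [he, AddChar.zmodChar_apply]
      exact sub_one_dvd_pow_sub_one _ _
    have h3 : ζ - 1 ∣ e (s * -c₀) - e (s * -c₁) := by
      have := dvd_sub (h2 (s * -c₀)) (h2 (s * -c₁))
      simpa using this
    rw [mul_comm]
    exact mul_dvd_mul h3 h1
  have hsum : ∀ d, ∑ s : ZMod p, e (s * -d) * ∑ c, (m c : R) * e (s * c) = p * m d := by
    intro d
    simp_rw [Finset.mul_sum]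
    rw [Finset.sum_comm]
    have : ∀ c, ∑ s : ZMod p, e (s * -d) * ((m c : R) * e (s * c)) =
        if c = d then (p : R) * m d else 0 := by
      intro c
      have h1 : ∀ s : ZMod p, e (s * -d) * ((m c : R) * e (s * c)) = m c * e (s * (c - d)) := by
        intro s
        rw [show s * (c - d) = s * -d + s * c by ring, AddChar.map_add_eq_mul]
        ring
      simp_rw [h1]
      rw [← Finset.mul_sum, AddChar.sum_mulShift _ hprim]
      by_cases hcd : c = d
      · simp [hcd, ZMod.card, mul_comm]
      · simp [hcd, sub_eq_zero]
    rw [Finset.sum_congr rfl fun c _ => this c]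
    simp
  have htot : (p : R) ^ n * (ζ - 1) ∣ p * (m c₀ - m c₁) := by
    have := Finset.dvd_sum (s := Finset.univ) fun s _ => hterm s
    simp_rw [sub_mul] at this
    rw [Finset.sum_sub_distrib, hsum, hsum, ← mul_sub] at this
    exact this
  obtain ⟨k, rfl⟩ : ∃ k, n = k + 1 := ⟨n - 1, by omega⟩
  rw [pow_succ', mul_assoc] at htot
  have h1 : (p : R) ^ k * (ζ - 1) ∣ m c₀ - m c₁ := (mul_dvd_mul_iff_left hp0).1 htot
  have h2 : (p : ℤ) ^ k ∣ m c₀ - m c₁ := by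
    apply hR
    push_cast
    exact (Dvd.intro _ rfl).trans h1
  obtain ⟨T, hT⟩ := h2
  -- Fourier inversion cost a factor `p`; the factor `ζ - 1` regains it, since an integer divisible
  -- by `ζ - 1` is divisible by `p`.
  have h3 : ζ - 1 ∣ (T : R) := by
    have : (m c₀ : R) - m c₁ = (p : R) ^ k * T := by exact_mod_cast congrArg (Int.cast (R := R)) hT
    rw [this] at h1
    exact (mul_dvd_mul_iff_left (pow_ne_zero _ hp0)).1 h1
  have h4 : (p : ℤ) ∣ T ^ p := by
    apply hR
    push_cast
    exact (prime_dvd_sub_one_pow hp hζ.pow_eq_one).trans (pow_dvd_pow_of_dvd h3 p)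
  have h5 : (p : ℤ) ∣ T := (Nat.prime_iff_prime_int.1 hp).dvd_of_dvd_pow h4
  rw [hT, pow_succ]
  exact mul_dvd_mul_left _ h5

end Cyclotomic

/-! ### Fibre counts and character sums -/

theorem sum_comp_eq_sum_card_mul {α β R : Type*} [Fintype α] [Fintype β] [CommRing R]
    (g : α → β) (F : β → R) :
    ∑ x, F (g x) = ∑ c, (Nat.card {x // g x = c} : R) * F c := by
  classical
  rw [← Finset.sum_fiberwise Finset.univ g]
  refine Finset.sum_congr rfl fun c _ => ?_
  rw [Finset.sum_congr rfl (g := fun _ => F c) fun x hx => by rw [(Finset.mem_filter.1 hx).2],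
    Finset.sum_const, nsmul_eq_mul, Nat.card_eq_fintype_card, Fintype.card_subtype]

/-- Adding one at `0`, as if `g` were extended by `g 0 = 0`, makes balance mean equal fibres. -/
theorem isBalanced_iff_card_add {F K : Type*} [Field F] [Finite F] [Field K] [DecidableEq F]
    {n : ℕ} {g : Kˣ → F} :
    IsBalanced n g ↔ ∀ c, (Nat.card {x // g x = c} : ℤ) + (if c = 0 then 1 else 0) =
      (Nat.card F : ℤ) ^ (n - 1) := by
  have hpos : 1 ≤ Nat.card F ^ (n - 1) := Nat.one_le_pow _ _ Nat.card_pos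
  constructor
  · rintro ⟨h0, h1⟩ c
    split_ifs with hc
    · rw [hc, h0]; push_cast [hpos]; ring
    · rw [h1 c hc]; push_cast; ring
  · intro h
    refine ⟨?_, fun b hb => ?_⟩
    · have := h 0
      rw [if_pos rfl] at this
      zify [hpos]
      linarith
    · have := h b
      rw [if_neg hb] at this
      zify
      linarith

theorem IsBalanced.sum_addChar {F K R : Type*} [Field F] [Fintype F] [Field K] [Fintype Kˣ]
    [CommRing R] [IsDomain R] {n : ℕ} {g : Kˣ → F} (hg : IsBalanced n g) {e : AddChar F R}
    (he : e ≠ 1) : ∑ x, e (g x) = -1 := by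
  classical
  rw [sum_comp_eq_sum_card_mul g e]
  have h : ∀ c, (Nat.card {x // g x = c} : R) =
      (Nat.card F : R) ^ (n - 1) - (if c = 0 then 1 else 0) := by
    intro c
    have := congrArg (Int.cast (R := R)) (isBalanced_iff_card_add.1 hg c)
    push_cast at this
    linear_combination this
  simp_rw [h, sub_mul]
  rw [Finset.sum_sub_distrib, ← Finset.mul_sum, AddChar.sum_eq_zero_of_ne_one he]
  simp

/-- Substitute `y = a * x`. -/
theorem sum_mul_sum_inv_eq_sum_correlation {G R : Type*} [CommGroup G] [Fintype G] [CommRing R]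
    (φ : G →* R) (u v : G → R) :
    (∑ y, φ y * u y) * (∑ x, φ x⁻¹ * v x) = ∑ a, φ a * ∑ x, u (a * x) * v x := by
  simp_rw [Finset.mul_sum]
  rw [Finset.sum_comm]
  refine Finset.sum_congr rfl fun x _ => ?_
  rw [Finset.sum_mul, ← Equiv.sum_comp (Equiv.mulRight x)]
  refine Finset.sum_congr rfl fun a _ => ?_
  have : φ (a * x) * φ x⁻¹ = φ a := by rw [← map_mul, mul_inv_cancel_right]
  simp only [Equiv.coe_mulRight]
  rw [← this]
  ring

/-- A finite cyclic group of order `N` embeds into a domain with a primitive `N`-th root of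
unity. -/
theorem exists_monoidHom_of_isPrimitiveRoot {G R : Type*} [CommGroup G] [Finite G] [IsCyclic G]
    [CommRing R] [IsDomain R] {ξ : R} (hξ : IsPrimitiveRoot ξ (Nat.card G)) :
    ∃ θ : G →* R, Function.Injective θ ∧ ∃ g, θ g = ξ := by
  have : NeZero (Nat.card G) := ⟨Nat.card_pos.ne'⟩
  have hc : Nat.card G = Nat.card (rootsOfUnity (Nat.card G) R) := hξ.card_rootsOfUnity.symm
  let E : G ≃* rootsOfUnity (Nat.card G) R := mulEquivOfCyclicCardEq hc
  refine ⟨(Units.coeHom R).comp ((rootsOfUnity (Nat.card G) R).subtype.comp E.toMonoidHom), ?_,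
    E.symm hξ.toRootsOfUnity, ?_⟩
  · intro x y h
    exact E.injective (Subtype.ext (Units.ext h))
  · simp

/-! ### Correlations of `f` with its multiples -/

section Correlation

variable {p n : ℕ} [Fact p.Prime] {K : Type*} [Field K]

/-- The correlation of `t * f` with `f` is `-1` modulo `p ^ n` at every shift, with sum `1`. -/
theorem prime_pow_dvd_correlation_add_one {R : Type*} [CommRing R] [IsDedekindDomain R]
    [Fintype Kˣ] (hn : 1 ≤ n) (hK : Nat.card K = p ^ n) {f : Kˣ → ZMod p}
    (hf : IsDifferenceBalanced n f) (hb : IsBalanced n f) (t : (ZMod p)ˣ)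
    {ζ ξ : R} (hζ : IsPrimitiveRoot ζ p) (hξ : IsPrimitiveRoot ξ (p ^ n - 1))
    {σ : R →+* R} (hσζ : σ ζ = ζ ^ (t : ZMod p).val) (hσξ : σ ξ = ξ)
    (hσ : ∀ y, ζ - 1 ∣ σ y - y) :
    (∀ a, (p : R) ^ n ∣
      (∑ x, AddChar.zmodChar p hζ.pow_eq_one (t * f (a * x) - f x)) + 1) ∧
    ∑ a, ∑ x, AddChar.zmodChar p hζ.pow_eq_one (t * f (a * x) - f x) = 1 := by
  classical
  have hp : p.Prime := Fact.out
  have hpn : 1 < p ^ n := Nat.one_lt_pow (by omega) hp.one_lt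
  have hfin : Finite K := Nat.finite_of_card_ne_zero (by rw [hK]; omega)
  have hcard : Nat.card Kˣ = p ^ n - 1 := by rw [Nat.card_units, hK]
  have hcardR : ((p ^ n - 1 : ℕ) : R) = (p : R) ^ n - 1 := by
    rw [Nat.cast_sub hpn.le]; push_cast; ring
  rw [← hcard] at hξ hcardR
  have hNcard : Nat.card Kˣ = Fintype.card Kˣ := Nat.card_eq_fintype_card
  set N := Nat.card Kˣ with hN
  have : NeZero N := ⟨by omega⟩
  obtain ⟨θ, hθ, g, hg⟩ := exists_monoidHom_of_isPrimitiveRoot (G := Kˣ) hξ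
  have hprim := AddChar.zmodChar_primitive_of_primitive_root p hζ
  set e := AddChar.zmodChar p hζ.pow_eq_one with he
  have he1 : e ≠ 1 := by
    have := hprim (a := 1) one_ne_zero
    rwa [AddChar.mulShift_one] at this
  have hte1 : AddChar.mulShift e (t : ZMod p) ≠ 1 := hprim t.ne_zero
  have hne1 : AddChar.mulShift e (-1 : ZMod p) ≠ 1 := hprim (neg_ne_zero.2 one_ne_zero)
  have hθN : ∀ x, θ x ^ N = 1 := fun x => by rw [← map_pow, pow_card_eq_one', map_one]
  have hσθ : ∀ x, σ (θ x) = θ x := by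
    intro x
    obtain ⟨i, -, hi⟩ := hξ.eq_pow_of_pow_eq_one (hθN x)
    rw [← hi, map_pow, hσξ]
  have hσe : ∀ c, σ (e c) = e (t * c) := by
    intro c
    rw [he, AddChar.zmodChar_apply, map_pow, hσζ, ← pow_mul]
    have : (t : ZMod p) * c = (((t : ZMod p).val * c.val : ℕ) : ZMod p) := by simp
    rw [this, AddChar.zmodChar_apply']
  have horth : ∀ x, ∑ j ∈ Finset.range N, (θ ^ j) x = if x = 1 then (N : R) else 0 := by
    intro x
    simp only [MonoidHom.pow_apply]
    split_ifs with hx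
    · simp [hx]
    · have h1 : θ x - 1 ≠ 0 := fun h => hx (hθ (by rw [map_one]; exact sub_eq_zero.1 h))
      have := geom_sum_mul (θ x) N
      rw [hθN, sub_self] at this
      exact (mul_eq_zero.1 this).resolve_right h1
  set X : ℕ → R := fun j => ∑ x, (θ ^ j) x * e (f x) with hX
  set X' : ℕ → R := fun j => ∑ x, (θ ^ j) x⁻¹ * e (-f x) with hX'
  set H : Kˣ → R := fun a => ∑ x, e (t * f (a * x) - f x) with hH
  have hsumt : ∑ x, e (t * f x) = -1 := by
    simpa [AddChar.mulShift_apply] using hb.sum_addChar hte1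
  have hsumn : ∑ x, e (-f x) = -1 := by
    simpa [AddChar.mulShift_apply] using hb.sum_addChar hne1
  have hXX' : ∀ j ∈ Finset.range N, j ≠ 0 → X j * X' j = (p : R) ^ n := by
    intro j hj hj0
    simp only [hX, hX']
    rw [sum_mul_sum_inv_eq_sum_correlation]
    have h1 : ∀ a : Kˣ, (∑ x, e (f (a * x)) * e (-f x)) =
        (if a = 1 then (p : R) ^ n else 0) - 1 := by
      intro a
      simp_rw [← AddChar.map_add_eq_mul, ← sub_eq_add_neg]
      split_ifs with ha
      · simp [ha, ← hNcard, hcardR]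
      · rw [(hf a ha).sum_addChar he1]; ring
    have h2 : ∑ a, (θ ^ j) a = 0 := by
      apply sum_hom_units_eq_zero
      intro h
      have := DFunLike.congr_fun h g
      rw [MonoidHom.pow_apply, hg, MonoidHom.one_apply] at this
      exact hξ.pow_ne_one_of_pos_of_lt hj0 (Finset.mem_range.1 hj) this
    simp_rw [h1, mul_sub]
    rw [Finset.sum_sub_distrib]
    simp_rw [mul_one]
    rw [h2]
    simp
  have hσX : ∀ j, σ (X j) * X' j = ∑ a, (θ ^ j) a * H a := by
    intro j
    simp only [hX, hX', hH, map_sum, map_mul, hσe]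
    have : ∀ x, σ ((θ ^ j) x) = (θ ^ j) x := fun x => by
      rw [MonoidHom.pow_apply, map_pow, hσθ]
    simp_rw [this]
    rw [sum_mul_sum_inv_eq_sum_correlation]
    simp_rw [← AddChar.map_add_eq_mul, ← sub_eq_add_neg]
  have hH0 : ∑ a, H a = 1 := by
    have := hσX 0
    simp only [pow_zero, MonoidHom.one_apply, one_mul] at this
    rw [← this]
    simp [hX, hX', hσe, hsumt, hsumn]
  refine ⟨fun a => ?_, hH0⟩
  have hinv : ∑ j ∈ Finset.range N, (θ ^ j) a⁻¹ * (σ (X j) * X' j) = N * H a := by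
    simp_rw [hσX, Finset.mul_sum]
    rw [Finset.sum_comm]
    have : ∀ b, ∑ j ∈ Finset.range N, (θ ^ j) a⁻¹ * ((θ ^ j) b * H b) =
        if b = a then (N : R) * H a else 0 := by
      intro b
      simp_rw [← mul_assoc, ← map_mul]
      rw [← Finset.sum_mul, horth]
      by_cases hab : a = b
      · simp [hab]
      · simp [hab, Ne.symm hab, inv_mul_eq_one]
    rw [Finset.sum_congr rfl fun b _ => this b]
    simp
  -- The term `j = 0` of the inversion formula is `1`; the others are divisible by `p ^ n`.
  have hdvd : (p : R) ^ n ∣ N * H a - 1 := by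
    have h0 : ∑ j ∈ Finset.range N, (if j = 0 then (1 : R) else 0) = 1 := by
      simp [NeZero.pos N]
    rw [← hinv, ← h0, ← Finset.sum_sub_distrib]
    refine Finset.dvd_sum fun j hj => ?_
    split_ifs with hj0
    · subst hj0
      rw [hσX]
      simp [hH0]
    · have h1 := hXX' j hj hj0
      have h2 : X j ∣ σ (X j) :=
        dvd_map_of_dvd_prime_pow hp hζ.pow_eq_one σ hσ (Dvd.intro _ h1)
      rw [sub_zero, ← h1]
      exact (mul_dvd_mul_right h2 _).mul_left _
  have hfinal : H a + 1 = (p : R) ^ n * H a - (N * H a - 1) := by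
    rw [hcardR]; ring
  have := dvd_sub (Dvd.intro (H a) rfl) hdvd
  rw [← hfinal] at this
  exact this

/-- Every nonzero multiple of a balanced and difference balanced function is a shift of it. -/
theorem exists_unit_mul_comp_mul_left_eq (hn : 1 ≤ n) (hK : Nat.card K = p ^ n)
    {f : Kˣ → ZMod p} (hf : IsDifferenceBalanced n f) (hb : IsBalanced n f) (t : (ZMod p)ˣ) :
    ∃ a : Kˣ, ∀ x, (t : ZMod p) * f (a * x) = f x := by
  classical
  have hp : p.Prime := Fact.out
  have hpn : 1 < p ^ n := Nat.one_lt_pow (by omega) hp.one_lt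
  have hfin : Finite K := Nat.finite_of_card_ne_zero (by rw [hK]; omega)
  have := Fintype.ofFinite Kˣ
  have hcard : Nat.card Kˣ = p ^ n - 1 := by rw [Nat.card_units, hK]
  have : NeZero (p ^ n - 1) := ⟨by omega⟩
  have hcop : Nat.Coprime p (p ^ n - 1) := by
    rw [hp.coprime_iff_not_dvd]
    intro h
    have h1 : p ∣ p ^ n := dvd_pow_self p (by omega)
    have h2 := Nat.dvd_sub h1 h
    rw [Nat.sub_sub_self hpn.le] at h2
    exact hp.one_lt.ne' (Nat.dvd_one.1 h2)
  obtain ⟨R, _, _, hR, ζ, ξ, hζ, hξ, hσ⟩ := exists_cyclotomic_ring p (p ^ n - 1) hcop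
  obtain ⟨σ, hσζ, hσξ, hσm⟩ := hσ (t : ZMod p).val (ZMod.val_coe_unit_coprime t)
  obtain ⟨hdvd, hsum⟩ := prime_pow_dvd_correlation_add_one hn hK hf hb t hζ hξ hσζ hσξ hσm
  by_contra! hno
  have hp0 : (p : R) ^ n ≠ 0 := by
    intro h
    have := hR 0 (p ^ n) (by push_cast; rw [h])
    rw [zero_dvd_iff] at this
    exact pow_ne_zero n (by exact_mod_cast hp.ne_zero) this
  have he1 : AddChar.zmodChar p hζ.pow_eq_one ≠ 1 := by
    have := AddChar.zmodChar_primitive_of_primitive_root p hζ (a := 1) one_ne_zero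
    rwa [AddChar.mulShift_one] at this
  set e := AddChar.zmodChar p hζ.pow_eq_one with he
  have hall : ∀ a : Kˣ, ∑ x, e (t * f (a * x) - f x) = -1 := by
    intro a
    refine IsBalanced.sum_addChar (n := n) (g := fun x => (t : ZMod p) * f (a * x) - f x) ?_ he1
    rw [isBalanced_iff_card_add]
    set m : ZMod p → ℤ := fun c =>
      (Nat.card {x // (t : ZMod p) * f (a * x) - f x = c} : ℤ) + (if c = 0 then 1 else 0) with hm
    have hm0 : ∀ c, 0 ≤ m c := fun c => by simp only [hm]; split_ifs <;> positivity
    have hmsum : ∑ c, m c = (p : ℤ) ^ n := by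
      have := sum_comp_eq_sum_card_mul (fun x : Kˣ => (t : ZMod p) * f (a * x) - f x)
        (fun _ => (1 : ℤ))
      simp only [hm]
      rw [Finset.sum_add_distrib]
      simp only [mul_one] at this
      rw [← this]
      simp only [Finset.sum_const, Finset.card_univ, ← Nat.card_eq_fintype_card, hcard]
      simp [hpn.le]
    have hcong := prime_pow_dvd_coeff_sub hR hζ
      (fun s hs => (hσ s hs).imp fun τ hτ => hτ.1) hn m (by
        have h1 := hdvd a
        rw [sum_comp_eq_sum_card_mul (fun x : Kˣ => (t : ZMod p) * f (a * x) - f x) e] at h1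
        convert h1 using 1
        simp only [hm]
        push_cast
        simp_rw [add_mul]
        rw [Finset.sum_add_distrib]
        simp [he])
    have hmle : ∀ c, m c ≤ (p : ℤ) ^ n := fun c =>
      hmsum ▸ Finset.single_le_sum (fun c _ => hm0 c) (Finset.mem_univ c)
    have hlt : ∀ c, m c < (p : ℤ) ^ n := by
      intro c
      refine lt_of_le_of_ne (hmle c) fun hc => ?_
      have hzero : ∀ d, d ≠ c → m d = 0 := by
        intro d hd
        have h1 := Finset.sum_le_sum_of_subset_of_nonneg (Finset.subset_univ {d, c})
          (f := m) fun i _ _ => hm0 i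
        rw [Finset.sum_pair hd, hmsum, hc] at h1
        have := hm0 d
        linarith
      -- The added one makes `m 0` positive, so a fibre of full weight must sit at `0`, contrary to
      -- `hno`.
      have hc0 : c = 0 := by
        by_contra hc0
        have := hzero 0 (Ne.symm hc0)
        simp only [hm, if_true] at this
        have h2 : (0 : ℤ) ≤ (Nat.card {x // (t : ZMod p) * f (a * x) - f x = 0} : ℤ) := by
          positivity
        linarith
      obtain ⟨x, hx⟩ := hno a
      have hx' : (t : ZMod p) * f (a * x) - f x ≠ 0 := sub_ne_zero.2 hx
      have h3 := hzero _ (hc0 ▸ hx')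
      simp only [hm, if_neg hx', add_zero, Nat.cast_eq_zero] at h3
      have : Nonempty {y // (t : ZMod p) * f (a * y) - f y = (t : ZMod p) * f (a * x) - f x} :=
        ⟨⟨x, rfl⟩⟩
      exact Nat.card_pos.ne' h3
    have heq : ∀ c d, m c = m d := by
      intro c d
      have h1 := Int.eq_zero_of_abs_lt_dvd (hcong c d)
        (abs_lt.2 ⟨by linarith [hm0 c, hlt d], by linarith [hm0 d, hlt c]⟩)
      linarith
    intro c
    change m c = _
    have h1 : (p : ℤ) * m c = p * (p : ℤ) ^ (n - 1) := by
      rw [← pow_succ', Nat.sub_add_cancel hn, ← hmsum, Finset.sum_congr rfl fun d _ => heq d c]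
      simp [ZMod.card]
    rw [Nat.card_zmod]
    exact mul_left_cancel₀ (by exact_mod_cast hp.ne_zero) h1
  rw [Finset.sum_congr rfl fun a _ => hall a] at hsum
  apply hp0
  simp only [Finset.sum_const, Finset.card_univ, ← Nat.card_eq_fintype_card, hcard,
    nsmul_eq_mul, Nat.cast_sub hpn.le] at hsum
  push_cast at hsum
  linear_combination -hsum

end Correlation

/-! ### Homogeneity and the balancing constant -/

section Homogeneous

variable {p n : ℕ} [Fact p.Prime] {K : Type*} [Field K]

theorem IsDifferenceBalanced.eq_one_of_comp_mul_left_eq {f : Kˣ → ZMod p}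
    (hf : IsDifferenceBalanced n f) {c : Kˣ} (hc : ∀ x, f (c * x) = f x) : c = 1 := by
  by_contra h
  have h1 := (hf c h).2 1 one_ne_zero
  simp only [hc, sub_self] at h1
  have : IsEmpty {x : Kˣ // (0 : ZMod p) = 1} := ⟨fun x => zero_ne_one x.2⟩
  rw [Nat.card_of_isEmpty, Nat.card_zmod] at h1
  exact pow_ne_zero (n - 1) (Fact.out : p.Prime).ne_zero h1.symm

theorem IsBalanced.exists_ne_zero {f : Kˣ → ZMod p} (hb : IsBalanced n f) : ∃ x, f x ≠ 0 := by
  by_contra! h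
  have h1 := hb.2 1 one_ne_zero
  simp only [h] at h1
  have : IsEmpty {x : Kˣ // (0 : ZMod p) = 1} := ⟨fun x => zero_ne_one x.2⟩
  rw [Nat.card_of_isEmpty, Nat.card_zmod] at h1
  exact pow_ne_zero (n - 1) (Fact.out : p.Prime).ne_zero h1.symm

/-- The exponent of an injective power endomorphism of a finite cyclic group is coprime to the
order of the group. -/
theorem gcd_eq_one_of_zpow_injective {G : Type*} [Group G] [Finite G] [IsCyclic G] {d : ℤ}
    (hd : Function.Injective fun g : G => g ^ d) : Int.gcd d (Nat.card G) = 1 := by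
  obtain ⟨g, hg⟩ := IsCyclic.exists_ofOrder_eq_natCard (α := G)
  obtain ⟨r, hr⟩ := Int.gcd_dvd_left d (Nat.card G)
  obtain ⟨q, hq⟩ := Int.gcd_dvd_right d (Nat.card G)
  set k := Int.gcd d (Nat.card G)
  have h1 : (g ^ q) ^ d = 1 := by
    rw [← zpow_mul, hr, ← mul_assoc, mul_comm q, ← hq, zpow_mul, ← hg, zpow_natCast,
      pow_orderOf_eq_one, one_zpow]
  have h2 : g ^ q = 1 := hd (by simpa using h1)
  obtain ⟨s, hs⟩ := orderOf_dvd_iff_zpow_eq_one.2 h2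
  rw [hg] at hs
  have hpos : (Nat.card G : ℤ) ≠ 0 := by exact_mod_cast Nat.card_pos.ne'
  have h3 : (Nat.card G : ℤ) * (k * s) = Nat.card G * 1 := by
    rw [mul_one]
    nth_rewrite 2 [hq]
    rw [hs]; ring
  have h4 := isUnit_of_dvd_one ⟨s, (mul_left_cancel₀ hpos h3).symm⟩
  exact_mod_cast Int.isUnit_iff_natAbs_eq.1 h4

theorem IsBalanced.exists_isHomogeneousOfDegree [Algebra (ZMod p) K] (hn : 1 ≤ n)
    (hK : Nat.card K = p ^ n) {f : Kˣ → ZMod p} (hf : IsDifferenceBalanced n f)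
    (hb : IsBalanced n f) : ∃ d : ℤ, IsHomogeneousOfDegree d f := by
  have hp : p.Prime := Fact.out
  have hex : ∀ t : (ZMod p)ˣ, ∃ a : Kˣ, ∀ x, f (a * x) = t * f x := by
    intro t
    obtain ⟨a, ha⟩ := exists_unit_mul_comp_mul_left_eq hn hK hf hb t⁻¹
    exact ⟨a, fun x => by rw [← ha x, Units.mul_inv_cancel_left]⟩
  choose α hα using hex
  have huniq : ∀ a b : Kˣ, (∀ x, f (a * x) = f (b * x)) → a = b := by
    intro a b h
    have := hf.eq_one_of_comp_mul_left_eq (c := a * b⁻¹) fun x => by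
      rw [mul_assoc, h, mul_inv_cancel_left]
    exact mul_inv_eq_one.1 this
  let A : (ZMod p)ˣ →* Kˣ :=
    { toFun := α
      map_one' := huniq _ _ fun x => by simp [hα]
      map_mul' := fun s t => huniq _ _ fun x => by
        rw [mul_assoc, hα, hα, hα, Units.val_mul, mul_assoc] }
  obtain ⟨x₀, hx₀⟩ := hb.exists_ne_zero
  have hA : Function.Injective A := by
    intro s t h
    have h1 := hα s x₀
    have h2 : α s = α t := h
    rw [h2, hα] at h1
    exact Units.ext (mul_right_cancel₀ hx₀ h1.symm)
  let ι : (ZMod p)ˣ →* Kˣ := Units.map (algebraMap (ZMod p) K : ZMod p →* K)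
  have hι : Function.Injective ι := Units.map_injective (algebraMap (ZMod p) K).injective
  -- In the field `K`, `A g` is a primitive root of unity of order `p - 1`, so its powers exhaust
  -- the roots of that order.
  have hrange : ∀ u, ι u ∈ A.range := by
    intro u
    obtain ⟨g, hg⟩ := IsCyclic.exists_ofOrder_eq_natCard (α := (ZMod p)ˣ)
    have horder : orderOf (A g : K) = Nat.card (ZMod p)ˣ := by
      rw [orderOf_units, orderOf_injective A hA, hg]
    have hprim : IsPrimitiveRoot (A g : K) (Nat.card (ZMod p)ˣ) :=
      horder ▸ IsPrimitiveRoot.orderOf _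
    have : NeZero (Nat.card (ZMod p)ˣ) := ⟨Nat.card_pos.ne'⟩
    obtain ⟨i, -, hi⟩ := hprim.eq_pow_of_pow_eq_one (ξ := (ι u : K)) (by
      rw [← Units.val_pow_eq_pow_val, ← map_pow, pow_card_eq_one', map_one, Units.val_one])
    exact ⟨g ^ i, Units.ext (by rw [map_pow, Units.val_pow_eq_pow_val, hi])⟩
  let B : (ZMod p)ˣ →* (ZMod p)ˣ :=
    (MonoidHom.ofInjective hA).symm.toMonoidHom.comp (ι.codRestrict A.range hrange)
  have hB : ∀ u, A (B u) = ι u := fun u =>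
    congrArg Subtype.val ((MonoidHom.ofInjective hA).apply_symm_apply ⟨ι u, hrange u⟩)
  -- An endomorphism of a cyclic group is a power map.
  obtain ⟨d, hd⟩ := B.map_cyclic
  refine ⟨d, ?_, fun u x => ?_⟩
  · have hinj : Function.Injective fun g : (ZMod p)ˣ => g ^ d := by
      intro u v h
      have h' : B u = B v := by rw [hd, hd]; exact h
      exact hι (by rw [← hB, ← hB, h'])
    have h1 := gcd_eq_one_of_zpow_injective hinj
    have h2 : (Nat.card (ZMod p)ˣ : ℤ) = (Nat.card (ZMod p) : ℤ) - 1 := by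
      rw [Nat.card_units, Nat.cast_sub Nat.card_pos]; simp
    rwa [h2] at h1
  · change f (ι u * x) = _
    rw [← hB u]
    change f (α (B u) * x) = _
    rw [hα, hd, Units.val_zpow_eq_zpow_val]

theorem IsDifferenceBalanced.sub_const {f : Kˣ → ZMod p} (hf : IsDifferenceBalanced n f)
    (b : ZMod p) : IsDifferenceBalanced n fun x => f x - b := by
  intro a ha
  simpa using hf a ha

theorem exists_eq_single_neg_one {ι : Type*} [Fintype ι] [DecidableEq ι] {e : ι → ℤ}
    (h1 : ∑ i, e i = -1) (h2 : ∑ i, e i ^ 2 = 1) : ∃ b, ∀ i, e i = if i = b then -1 else 0 := by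
  obtain ⟨b, -, hb⟩ : ∃ b ∈ Finset.univ, e b ≠ 0 := by
    apply Finset.exists_ne_zero_of_sum_ne_zero
    rw [h1]; norm_num
  have hb1 : 1 ≤ e b ^ 2 := Int.add_one_le_iff.2 (sq_pos_of_ne_zero hb)
  have hzero : ∀ i, i ≠ b → e i = 0 := by
    intro i hi
    have := Finset.sum_le_sum_of_subset_of_nonneg (Finset.subset_univ {i, b})
      (f := fun i => e i ^ 2) fun i _ _ => sq_nonneg _
    rw [Finset.sum_pair hi, h2] at this
    have h3 := sq_nonneg (e i)
    exact pow_eq_zero_iff two_ne_zero |>.1 (by linarith)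
  refine ⟨b, fun i => ?_⟩
  split_ifs with hi
  · rw [hi, ← h1]
    exact (Finset.sum_eq_single b (fun j _ hj => hzero j hj) (by simp)).symm
  · exact hzero i hi

/-- Counting the pairs with equal values of a difference balanced function. -/
theorem IsDifferenceBalanced.sum_card_fiber_sq (hn : 1 ≤ n) (hK : Nat.card K = p ^ n)
    {f : Kˣ → ZMod p} (hf : IsDifferenceBalanced n f) :
    ∑ c, (Nat.card {x // f x = c} : ℤ) ^ 2 =
      (p ^ n - 1) + (p ^ n - 2) * (p ^ (n - 1) - 1) := by
  classical
  have hp : p.Prime := Fact.out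
  have hpn : 1 < p ^ n := Nat.one_lt_pow (by omega) hp.one_lt
  have hfin : Finite K := Nat.finite_of_card_ne_zero (by rw [hK]; omega)
  have := Fintype.ofFinite Kˣ
  have hcard : (Nat.card Kˣ : ℤ) = p ^ n - 1 := by
    rw [Nat.card_units, hK, Nat.cast_sub hpn.le]; simp
  have hind : ∀ (g : Kˣ → ZMod p) c,
      (Nat.card {x // g x = c} : ℤ) = ∑ x, if g x = c then 1 else 0 := by
    intro g c
    rw [Nat.card_eq_fintype_card, Fintype.card_subtype, Finset.card_filter]
    push_cast
    rfl
  have h1 : ∑ c, (Nat.card {x // f x = c} : ℤ) ^ 2 =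
      ∑ x, (Nat.card {y // f y = f x} : ℤ) := by
    rw [sum_comp_eq_sum_card_mul f fun c => (Nat.card {y // f y = c} : ℤ)]
    simp_rw [sq]
  have h2 : ∑ x, (Nat.card {y // f y = f x} : ℤ) =
      ∑ a : Kˣ, (Nat.card {x // f (a * x) - f x = 0} : ℤ) := by
    simp_rw [hind (fun x => f (_ * x) - f x), hind f]
    rw [Finset.sum_comm (γ := Kˣ) (s := Finset.univ) (t := Finset.univ)
      (f := fun a x => if f (a * x) - f x = 0 then (1 : ℤ) else 0)]
    refine Finset.sum_congr rfl fun x _ => ?_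
    rw [← Equiv.sum_comp (Equiv.mulRight x)]
    exact Finset.sum_congr rfl fun a _ => if_congr sub_eq_zero.symm rfl rfl
  rw [h1, h2, ← Finset.add_sum_erase _ _ (Finset.mem_univ (1 : Kˣ))]
  have h3 : (Nat.card {x : Kˣ // f (1 * x) - f x = 0} : ℤ) = p ^ n - 1 := by
    rw [hind fun x => f (1 * x) - f x, ← hcard, Nat.card_eq_fintype_card]
    simp
  have h4 : ∀ a ∈ Finset.univ.erase (1 : Kˣ),
      (Nat.card {x : Kˣ // f (a * x) - f x = 0} : ℤ) = p ^ (n - 1) - 1 := by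
    intro a ha
    have := isBalanced_iff_card_add.1 (hf a (Finset.ne_of_mem_erase ha)) 0
    rw [if_pos rfl, Nat.card_zmod] at this
    linarith
  have h5 : ((Finset.univ.erase (1 : Kˣ)).card : ℤ) = p ^ n - 2 := by
    rw [Finset.card_erase_of_mem (Finset.mem_univ _), Finset.card_univ,
      Nat.cast_sub Fintype.card_pos, ← Nat.card_eq_fintype_card, hcard]
    push_cast
    ring
  rw [h3, Finset.sum_congr rfl h4, Finset.sum_const, nsmul_eq_mul, h5]

/-- The deviations of the fibre sizes from `p ^ (n - 1)` are integers with sum `-1` and sum of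
squares `1`, so just one fibre is short, by one; its value is `b`. -/
theorem IsDifferenceBalanced.exists_isBalanced_sub (hn : 1 ≤ n) (hK : Nat.card K = p ^ n)
    {f : Kˣ → ZMod p} (hf : IsDifferenceBalanced n f) :
    ∃ b : ZMod p, IsBalanced n fun x => f x - b := by
  have hp : p.Prime := Fact.out
  have hpn : 1 < p ^ n := Nat.one_lt_pow (by omega) hp.one_lt
  have hfin : Finite K := Nat.finite_of_card_ne_zero (by rw [hK]; omega)
  have := Fintype.ofFinite Kˣ
  have hcard : (Fintype.card Kˣ : ℤ) = p ^ n - 1 := by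
    rw [← Nat.card_eq_fintype_card, Nat.card_units, hK, Nat.cast_sub hpn.le]; simp
  have hsum : ∑ c, (Nat.card {x // f x = c} : ℤ) = p ^ n - 1 := by
    have := sum_comp_eq_sum_card_mul f fun _ => (1 : ℤ)
    simpa [hcard] using this.symm
  have hsq := hf.sum_card_fiber_sq hn hK
  have hpow : (p : ℤ) ^ n = p * p ^ (n - 1) := by rw [← pow_succ', Nat.sub_add_cancel hn]
  rw [hpow] at hsum hsq
  obtain ⟨b, hb⟩ := exists_eq_single_neg_one
    (e := fun c => (Nat.card {x // f x = c} : ℤ) - p ^ (n - 1))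
    (by
      rw [Finset.sum_sub_distrib, hsum]
      simp [ZMod.card])
    (by
      simp_rw [sub_sq]
      rw [Finset.sum_add_distrib, Finset.sum_sub_distrib, hsq, ← Finset.sum_mul,
        ← Finset.mul_sum, hsum]
      simp only [Finset.sum_const, Finset.card_univ, ZMod.card, nsmul_eq_mul]
      ring)
  refine ⟨b, isBalanced_iff_card_add.2 fun c => ?_⟩
  have h := hb (c + b)
  simp only [sub_eq_iff_eq_add, Nat.card_zmod, add_eq_right] at h ⊢
  rw [h]
  split_ifs <;> ring

end Homogeneous

theorem theorem5p3 (p n : ℕ) [Fact p.Prime] (K : Type*) [Field K] [Algebra (ZMod p) K]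
    (hK : Nat.card K = p ^ n) (f : Kˣ → ZMod p) (hf : IsDifferenceBalanced n f) :
    (IsBalanced n f → ∃ d : ℤ, IsHomogeneousOfDegree d f) ∧
      ∃ b : ZMod p, IsBalanced n (fun x : Kˣ => f x - b) ∧
        ∃ d : ℤ, IsHomogeneousOfDegree d (fun x : Kˣ => f x - b) := by
  have hn : 1 ≤ n := by
    by_contra h
    have h0 : n = 0 := by omega
    rw [h0, pow_zero, Nat.card_eq_one_iff_unique] at hK
    have := hK.1
    exact zero_ne_one (Subsingleton.elim (0 : K) 1)
  refine ⟨fun hb => hb.exists_isHomogeneousOfDegree hn hK hf, ?_⟩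
  obtain ⟨b, hb⟩ := hf.exists_isBalanced_sub hn hK
  exact ⟨b, hb, hb.exists_isHomogeneousOfDegree hn hK (hf.sub_const b)⟩
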